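/- Let $(X,\varphi)$ be a Smale space: a homeomorphism of a compact metric space with a bracket $[\cdot,\cdot]$, defined and continuous on $\{d(x,y)\le\varepsilon_X\}$, satisfying the usual axioms ($[x,x]=x$, $[x,[y,z]]=[x,z]$, $[[x,y],z]=[x,z]$, $\varphi[x,y]=[\varphi x,\varphi y]$ whenever both sides are defined; $\varphi$ contracts by a factor $\lambda<1$ the distance of $y,z$ with $[y,z]=z$, and $\varphi^{-1}$ that of $y,z$ with $[y,z]=y$). Let $\pi=(Y,\psi,\pi_s,Z,\zeta,\pi_u)$ be an $s/u$-bijective pair for $(X,\varphi)$: $(Y,\psi)$ and $(Z,\zeta)$ are Smale spaces, $\pi_s\colon Y\to X$ and $\pi_u\colon Z\to X$ are continuous equivariant surjections, $\pi_s$ maps each global stable set $Y^s(y)$ bijectively onto $X^s(\pi_s(y))$, $\pi_u$ maps each global unstable set $Z^u(z)$ bijectively onto $X^u(\pi_u(z))$, and all the sets $Y^u(y)$ and $Z^s(z)$ are totally disconnected. For $L,M\ge 0$ let $$\Sigma_{L,M}=\{(y_0,\dots,y_L,z_0,\dots,z_M) : y_l\in Y,\ z_m\in Z,\ \pi_s(y_l)=\pi_u(z_m)\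 \text{for all } l,m\},$$ with the coordinatewise dynamics $\sigma$ and bracket. For $\Sigma=\Sigma_{L,M}$, let $CO^s(\Sigma)$ be the family of compact open subsets of the stable orbits $\Sigma^s(e)$, $e\in\Sigma$ (each orbit with the topology whose neighbourhood bases are the local stable sets), and let $\sim$ be the smallest equivalence relation on $CO^s(\Sigma)$ such that $E\sim F$ whenever $E$ and $F$ lie in local stable sets, $[E,F]$ and $[F,E]$ are defined, $[E,F]=E$ and $[F,E]=F$, and such that $E\sim F$ if and only if $\sigma(E)\sim\sigma(F)$. The dimension group $D^s(\Sigma)$ is the free abelian group on the classes $[E]$ modulo the subgroup generated by all $[E\cup F]-[E]-[F]$ with $E,F,E\cup F\in CO^s(\Sigma)$ and $E\cap F=\emptyset$. Put $C_{L,M}=D^s(\Sigma_{L,M})$. The symmetric group $S_{L+1}$ acts on $\Sigma_{L,M}$ by permuting $y_0,\dots,y_L$, hence on $C_{L,M}$. For $0\le l<p\le L+1$ the degeneracy $$d_{l,p}\colon\Sigma_{L,M}\to\Sigma_{L+1,M},\qquad (y_0,\dots,y_L,z)\mapsto(y_0,\dots,y_{p-1},y_l,y_p,\dots,y_L,z)$$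 induces $d_{l,p}^s\colon C_{L,M}\to C_{L+1,M}$, $[E]\mapsto[d_{l,p}(E)]$. Let $DC_{L,M}\subseteq C_{L,M}$ be the subgroup generated by the images of all the maps $d^s_{l,p}\colon C_{L-1,M}\to C_{L,M}$ (there are none if $L=0$) and by all $\alpha(a)-\operatorname{sgn}(\alpha)a$ with $a\in C_{L,M}$, $\alpha\in S_{L+1}$. Let $D^s_{\mathcal B}(\Sigma_{L,M})\subseteq C_{L,M}$ be the subgroup generated by all $a$ with $\alpha(a)=a$ for some transposition $\alpha\in S_{L+1}$ and by all $a-\operatorname{sgn}(\alpha)\alpha(a)$ with $a\in C_{L,M}$, $\alpha\in S_{L+1}$, and let $(C_{\mathcal Q})_{L,M}=D^s(\Sigma_{L,M})/D^s_{\mathcal B}(\Sigma_{L,M})$. **Proposition.** Suppose that $\pi_s$ is finite-to-one. Then the cardinalities of the fibers of $\pi_s$ have a maximum $K$ (taken to be $0$ if $X=\emptyset$), and with $N=K+1$, for all $L\ge N$ and all $M\ge 0$: 1. every generator $[E]$ of $D^s(\Sigma_{L,M})$, $E\in CO^s(\Sigma_{L,M})$, is degenerate: $[E]=d^s_{l,p}[F]$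 for some $0\le l<p\le L$ and some $F\in CO^s(\Sigma_{L-1,M})$; 2. $C_{L,M}=DC_{L,M}$; 3. $(C_{\mathcal Q})_{L,M}=0$. -/

import Mathlib

open Set Filter Topology

noncomputable section

/-! ### Dynamical systems with a partially defined bracket -/

/-- A homeomorphism of a metric space with a partially defined bracket operation:
`IsBracket x y z` says that `[x, y]` is defined and equal to `z`. -/
structure BracketSystem (T : Type*) [MetricSpace T] where
  /-- the dynamics -/
  φ : T ≃ₜ T
  /-- the graph of the bracket -/
  IsBracket : T → T → T → Prop
  unique : ∀ {x y z z' : T}, IsBracket x y z → IsBracket x y z' → z = z'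

/-- The topology in which `U` is open iff around each `y ∈ U` it contains all the `z` which are
close to `y` and satisfy `loc y z`. -/
abbrev leafTopology {T : Type*} [MetricSpace T] (loc : T → T → Prop) : TopologicalSpace T where
  IsOpen U := ∀ y ∈ U, ∃ δ > 0, ∀ z, dist y z < δ → loc y z → z ∈ U
  isOpen_univ := fun _ _ => ⟨1, one_pos, fun _ _ _ => mem_univ _⟩
  isOpen_inter := fun U V hU hV y hy => by
    obtain ⟨a, ha, h1⟩ := hU y hy.1
    obtain ⟨b, hb, h2⟩ := hV y hy.2
    exact ⟨min a b, lt_min ha hb, fun z hz hl =>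
      ⟨h1 z (hz.trans_le (min_le_left _ _)) hl, h2 z (hz.trans_le (min_le_right _ _)) hl⟩⟩
  isOpen_sUnion := fun 𝒰 h𝒰 y hy => by
    obtain ⟨U, hU, hyU⟩ := hy
    obtain ⟨a, ha, h1⟩ := h𝒰 U hU y hyU
    exact ⟨a, ha, fun z hz hl => ⟨U, hU, h1 z hz hl⟩⟩

namespace BracketSystem

variable {T : Type*} [MetricSpace T] (S : BracketSystem T)

/-- Stable equivalence. -/
def StablyEquiv (x y : T) : Prop :=
  Tendsto (fun n : ℕ => dist (S.φ^[n] x) (S.φ^[n] y)) atTop (𝓝 0)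

/-- Unstable equivalence. -/
def UnstablyEquiv (x y : T) : Prop :=
  Tendsto (fun n : ℕ => dist (S.φ.symm^[n] x) (S.φ.symm^[n] y)) atTop (𝓝 0)

/-- The global stable set (stable orbit) of `x`. -/
def stableSet (x : T) : Set T := {y | S.StablyEquiv x y}

/-- The global unstable set of `x`. -/
def unstableSet (x : T) : Set T := {y | S.UnstablyEquiv x y}

/-- The topology of the stable orbits, all at once (each stable orbit of a Smale space is open in
it): the local stable sets `{z | d(y, z) < δ, [y, z] = z}` form a neighbourhood base at `y`. -/
abbrev stableTopology : TopologicalSpace T := leafTopology fun y z => S.IsBracket y z z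

/-- The topology of the unstable orbits, all at once: the local unstable sets
`{z | d(y, z) < δ, [z, y] = z}` form a neighbourhood base at `y`. -/
abbrev unstableTopology : TopologicalSpace T := leafTopology fun y z => S.IsBracket z y z

/-- `E` is a compact open subset of some stable orbit. -/
def IsCO (E : Set T) : Prop :=
  (∃ e, E ⊆ S.stableSet e) ∧ @IsCompact T S.stableTopology E ∧ @IsOpen T S.stableTopology E

/-- The compact open subsets of the stable orbits. -/
def CO : Type _ := {E : Set T // S.IsCO E}

/-- `E` lies in a local stable set (around each of its points). -/
def IsLocal (E : Set T) : Prop := ∀ e ∈ E, ∀ e' ∈ E, S.IsBracket e e' e'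

/-- `[e, f]` is defined for all `e ∈ E` and `f ∈ F`. -/
def BracketDefined (E F : Set T) : Prop := ∀ e ∈ E, ∀ f ∈ F, ∃ g, S.IsBracket e f g

/-- `[E, F] = {[e, f] | e ∈ E, f ∈ F}`. -/
def bracketSet (E F : Set T) : Set T := {g | ∃ e ∈ E, ∃ f ∈ F, S.IsBracket e f g}

/-- The smallest equivalence relation `∼` on compact open sets such that `E ∼ F` if `E` and `F`
lie in local stable sets, `[E, F]` and `[F, E]` are defined, `[E, F] = E` and `[F, E] = F`,
and such that `E ∼ F` if and only if `φ(E) ∼ φ(F)`. -/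
inductive Rel : S.CO → S.CO → Prop
  | base (E F : S.CO) : S.IsLocal E.1 → S.IsLocal F.1 →
      S.BracketDefined E.1 F.1 → S.BracketDefined F.1 E.1 →
      S.bracketSet E.1 F.1 = E.1 → S.bracketSet F.1 E.1 = F.1 → Rel E F
  | shift (E F E' F' : S.CO) : E'.1 = S.φ '' E.1 → F'.1 = S.φ '' F.1 → Rel E F → Rel E' F'
  | unshift (E F E' F' : S.CO) : E'.1 = S.φ '' E.1 → F'.1 = S.φ '' F.1 → Rel E' F' → Rel E F
  | refl (E : S.CO) : Rel E E
  | symm (E F : S.CO) : Rel E F → Rel F E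
  | trans (E F G : S.CO) : Rel E F → Rel F G → Rel E G

/-- The relation `∼` as a setoid. -/
def relSetoid : Setoid S.CO := ⟨S.Rel, Rel.refl, fun h => Rel.symm _ _ h, Rel.trans _ _ _⟩

/-- The `∼`-equivalence class of a compact open set. -/
def cls (E : S.CO) : Quotient S.relSetoid := Quotient.mk _ E

/-- The subgroup generated by `[E ∪ F] - [E] - [F]` with `E`, `F` disjoint. -/
def additivity : AddSubgroup (FreeAbelianGroup (Quotient S.relSetoid)) :=
  AddSubgroup.closure {a | ∃ E F G : S.CO, Disjoint E.1 F.1 ∧ G.1 = E.1 ∪ F.1 ∧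
    a = FreeAbelianGroup.of (S.cls G) - FreeAbelianGroup.of (S.cls E)
      - FreeAbelianGroup.of (S.cls F)}

/-- The (stable) dimension group. -/
abbrev Ds : Type _ := FreeAbelianGroup (Quotient S.relSetoid) ⧸ S.additivity

/-- The generator `[E]` of the dimension group. -/
def gen (E : S.CO) : S.Ds := QuotientAddGroup.mk (FreeAbelianGroup.of (S.cls E))

/-- An equivariant map compatible with the brackets which is bijective on stable orbits and
carries compact open sets to compact open sets. -/
structure StableMap {T' : Type*} [MetricSpace T'] (S' : BracketSystem T') (f : T → T') :
    Prop where
  equivariant : ∀ x, f (S.φ x) = S'.φ (f x)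
  bracket : ∀ x y z, S.IsBracket x y z → S'.IsBracket (f x) (f y) (f z)
  bijOn : ∀ x, BijOn f (S.stableSet x) (S'.stableSet (f x))
  isCO : ∀ E, S.IsCO E → S'.IsCO (f '' E)

namespace StableMap

variable {S} {T' : Type*} [MetricSpace T'] {S' : BracketSystem T'} {f : T → T'}

/-- `E ↦ f(E)`. -/
def image (hf : S.StableMap S' f) (E : S.CO) : S'.CO := ⟨f '' E.1, hf.isCO E.1 E.2⟩

theorem rel_image (hf : S.StableMap S' f) {E F : S.CO} (h : S.Rel E F) :
    S'.Rel (hf.image E) (hf.image F) := by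
  have hl : ∀ E : Set T, S.IsLocal E → S'.IsLocal (f '' E) := by
    rintro E hE _ ⟨e, he, rfl⟩ _ ⟨e', he', rfl⟩
    exact hf.bracket _ _ _ (hE e he e' he')
  have hd : ∀ E F : Set T, S.BracketDefined E F → S'.BracketDefined (f '' E) (f '' F) := by
    rintro E F h _ ⟨e, he, rfl⟩ _ ⟨g, hg, rfl⟩
    obtain ⟨k, hk⟩ := h e he g hg
    exact ⟨f k, hf.bracket _ _ _ hk⟩
  have hb : ∀ E F : Set T, S.BracketDefined E F → S.bracketSet E F = E →
      S'.bracketSet (f '' E) (f '' F) = f '' E := by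
    intro E F h hE
    ext w
    constructor
    · rintro ⟨_, ⟨e, he, rfl⟩, _, ⟨g, hg, rfl⟩, hw⟩
      obtain ⟨k, hk⟩ := h e he g hg
      refine ⟨k, ?_, S'.unique (hf.bracket _ _ _ hk) hw⟩
      rw [← hE]
      exact ⟨e, he, g, hg, hk⟩
    · rintro ⟨k, hk, rfl⟩
      rw [← hE] at hk
      obtain ⟨e, he, g, hg, hk⟩ := hk
      exact ⟨_, ⟨e, he, rfl⟩, _, ⟨g, hg, rfl⟩, hf.bracket _ _ _ hk⟩
  have hs : ∀ E E' : S.CO, E'.1 = S.φ '' E.1 → (hf.image E').1 = S'.φ '' (hf.image E).1 := by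
    intro E E' h
    simp only [image, h, image_image, hf.equivariant]
  induction h with
  | base E F h1 h2 h3 h4 h5 h6 =>
    exact Rel.base _ _ (hl _ h1) (hl _ h2) (hd _ _ h3) (hd _ _ h4) (hb _ _ h3 h5) (hb _ _ h4 h6)
  | shift E F E' F' h1 h2 _ ih => exact Rel.shift _ _ _ _ (hs _ _ h1) (hs _ _ h2) ih
  | unshift E F E' F' h1 h2 _ ih => exact Rel.unshift _ _ _ _ (hs _ _ h1) (hs _ _ h2) ih
  | refl E => exact Rel.refl _
  | symm E F _ ih => exact Rel.symm _ _ ih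
  | trans E F G _ _ ih1 ih2 => exact Rel.trans _ _ _ ih1 ih2

/-- `[E] ↦ [f(E)]` on `∼`-equivalence classes. -/
def clsMap (hf : S.StableMap S' f) : Quotient S.relSetoid → Quotient S'.relSetoid :=
  Quotient.map' hf.image fun _ _ h => hf.rel_image h

theorem additivity_le (hf : S.StableMap S' f) :
    S.additivity ≤ S'.additivity.comap (FreeAbelianGroup.map hf.clsMap) := by
  refine (AddSubgroup.closure_le _).2 ?_
  rintro _ ⟨E, F, G, hd, hG, rfl⟩
  refine AddSubgroup.subset_closure ⟨hf.image E, hf.image F, hf.image G, ?_, ?_, ?_⟩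
  · obtain ⟨x, hx⟩ := G.2.1
    have hE : E.1 ⊆ S.stableSet x := (hG ▸ subset_union_left : E.1 ⊆ G.1).trans hx
    have hF : F.1 ⊆ S.stableSet x := (hG ▸ subset_union_right : F.1 ⊆ G.1).trans hx
    rw [Set.disjoint_left] at hd ⊢
    rintro _ ⟨a, ha, rfl⟩ ⟨b, hb, hab⟩
    have := (hf.bijOn x).injOn (hF hb) (hE ha) hab
    exact hd ha (this ▸ hb)
  · simp only [image, hG, image_union]
  · simp only [map_sub, FreeAbelianGroup.map_of_apply]
    rfl

/-- The induced homomorphism `f^s` of dimension groups, `[E] ↦ [f(E)]`. -/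
def dsMap (hf : S.StableMap S' f) : S.Ds →+ S'.Ds :=
  QuotientAddGroup.map S.additivity S'.additivity (FreeAbelianGroup.map hf.clsMap)
    hf.additivity_le

theorem dsMap_gen (hf : S.StableMap S' f) (E : S.CO) :
    hf.dsMap (S.gen E) = S'.gen (hf.image E) := by
  simp only [dsMap, gen, QuotientAddGroup.map_mk, FreeAbelianGroup.map_of_apply]
  rfl

end StableMap

end BracketSystem

/-! ### Smale spaces and s/u-bijective pairs -/

/-- A Smale space structure on a compact metric space. The bracket `[x, y]` is only meaningful
for `d(x, y) ≤ ε`; the algebraic axioms hold whenever both sides are defined. -/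
structure SmaleSpace (X : Type*) [MetricSpace X] [CompactSpace X] where
  /-- the dynamics -/
  φ : X ≃ₜ X
  /-- the bracket -/
  br : X → X → X
  /-- the size of the domain of the bracket -/
  ε : ℝ
  /-- the contraction constant -/
  lam : ℝ
  ε_pos : 0 < ε
  lam_pos : 0 < lam
  lam_lt_one : lam < 1
  br_continuous : ContinuousOn (fun p : X × X => br p.1 p.2) {p | dist p.1 p.2 ≤ ε}
  br_self : ∀ x, br x x = x
  br_br_right : ∀ x y z, dist y z ≤ ε → dist x (br y z) ≤ ε → dist x z ≤ ε →
    br x (br y z) = br x z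
  br_br_left : ∀ x y z, dist x y ≤ ε → dist (br x y) z ≤ ε → dist x z ≤ ε →
    br (br x y) z = br x z
  br_map : ∀ x y, dist x y ≤ ε → dist (φ x) (φ y) ≤ ε → φ (br x y) = br (φ x) (φ y)
  contract : ∀ y z, dist y z ≤ ε → br y z = z → dist (φ y) (φ z) ≤ lam * dist y z
  contract_symm : ∀ y z, dist y z ≤ ε → br y z = y →
    dist (φ.symm y) (φ.symm z) ≤ lam * dist y z

namespace SmaleSpace

variable {X : Type*} [MetricSpace X] [CompactSpace X]

/-- The underlying system with partially defined bracket. -/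
def sys (S : SmaleSpace X) : BracketSystem X where
  φ := S.φ
  IsBracket x y z := dist x y ≤ S.ε ∧ S.br x y = z
  unique h h' := h.2.symm.trans h'.2

theorem stablyEquiv_of_isBracket (S : SmaleSpace X) {y z : X} (h : S.sys.IsBracket y z z) :
    S.sys.StablyEquiv y z := by
  have key : ∀ n : ℕ, dist (S.φ^[n] y) (S.φ^[n] z) ≤ S.lam ^ n * dist y z ∧
      dist (S.φ^[n] y) (S.φ^[n] z) ≤ S.ε ∧ S.br (S.φ^[n] y) (S.φ^[n] z) = S.φ^[n] z := by
    intro n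
    induction n with
    | zero => exact ⟨by simp, h.1, h.2⟩
    | succ n ih =>
      obtain ⟨h1, h2, h3⟩ := ih
      simp only [Function.iterate_succ_apply']
      have h4 := S.contract _ _ h2 h3
      have h5 : dist (S.φ (S.φ^[n] y)) (S.φ (S.φ^[n] z)) ≤ S.ε :=
        h4.trans ((mul_le_of_le_one_left dist_nonneg S.lam_lt_one.le).trans h2)
      refine ⟨h4.trans ?_, h5, ?_⟩
      · rw [pow_succ', mul_assoc]
        exact mul_le_mul_of_nonneg_left h1 S.lam_pos.le
      · rw [← S.br_map _ _ h2 h5, h3]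
  refine squeeze_zero (fun _ => dist_nonneg) (fun n => (key n).1) ?_
  simpa using (tendsto_pow_atTop_nhds_zero_of_lt_one S.lam_pos.le S.lam_lt_one).mul_const
    (dist y z)

end SmaleSpace

/-- An s/u-bijective pair for a Smale space `X`: Smale spaces `Y`, `Z` with factor maps
`πs : Y → X`, `πu : Z → X` such that `πs` is s-bijective and the unstable sets of `Y` are totally
disconnected, while `πu` is u-bijective and the stable sets of `Z` are totally disconnected. -/
structure SUBijectivePair {X Y Z : Type*} [MetricSpace X] [CompactSpace X] [MetricSpace Y]
    [CompactSpace Y] [MetricSpace Z] [CompactSpace Z]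
    (SX : SmaleSpace X) (SY : SmaleSpace Y) (SZ : SmaleSpace Z) where
  /-- the s-bijective factor map -/
  πs : Y → X
  /-- the u-bijective factor map -/
  πu : Z → X
  πs_continuous : Continuous πs
  πs_surjective : Function.Surjective πs
  πs_map : ∀ y, πs (SY.φ y) = SX.φ (πs y)
  πs_bijOn : ∀ y, BijOn πs (SY.sys.stableSet y) (SX.sys.stableSet (πs y))
  Y_disconnected : ∀ y, @IsTotallyDisconnected Y SY.sys.unstableTopology (SY.sys.unstableSet y)
  πu_continuous : Continuous πu
  πu_surjective : Function.Surjective πu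
  πu_map : ∀ z, πu (SZ.φ z) = SX.φ (πu z)
  πu_bijOn : ∀ z, BijOn πu (SZ.sys.unstableSet z) (SX.sys.unstableSet (πu z))
  Z_disconnected : ∀ z, @IsTotallyDisconnected Z SZ.sys.stableTopology (SZ.sys.stableSet z)

namespace SUBijectivePair

variable {X Y Z : Type*} [MetricSpace X] [CompactSpace X] [MetricSpace Y]
  [CompactSpace Y] [MetricSpace Z] [CompactSpace Z]
  {SX : SmaleSpace X} {SY : SmaleSpace Y} {SZ : SmaleSpace Z} (π : SUBijectivePair SX SY SZ)

/-! ### The systems `Σ_{L,M}` -/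

/-- The space `Σ_{L,M}` of tuples `(y_0, …, y_L, z_0, …, z_M)` with `πs(y_l) = πu(z_m)`, with the
maximum metric. -/
abbrev Space (L M : ℕ) : Type _ :=
  {w : (Fin (L + 1) → Y) × (Fin (M + 1) → Z) // ∀ l m, π.πs (w.1 l) = π.πu (w.2 m)}

/-- `Σ_{L,M}` with the coordinatewise dynamics and the coordinatewise bracket. -/
def sys (L M : ℕ) : BracketSystem (π.Space L M) where
  φ := Homeomorph.subtype
    ((Homeomorph.piCongrRight fun _ => SY.φ).prodCongr (Homeomorph.piCongrRight fun _ => SZ.φ))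
    (by
      intro w
      change _ ↔ ∀ l m, π.πs (SY.φ (w.1 l)) = π.πu (SZ.φ (w.2 m))
      simp only [π.πs_map, π.πu_map, SX.φ.injective.eq_iff])
  IsBracket v w u := (∀ l, SY.sys.IsBracket (v.1.1 l) (w.1.1 l) (u.1.1 l)) ∧
    ∀ m, SZ.sys.IsBracket (v.1.2 m) (w.1.2 m) (u.1.2 m)
  unique h h' := Subtype.ext (Prod.ext (funext fun l => SY.sys.unique (h.1 l) (h'.1 l))
    (funext fun m => SZ.sys.unique (h.2 m) (h'.2 m)))

/-- The reindexing map `(y, z) ↦ (y ∘ g, z)`. -/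
def reindex {L L' : ℕ} (M : ℕ) (g : Fin (L' + 1) → Fin (L + 1)) (w : π.Space L M) :
    π.Space L' M :=
  ⟨(w.1.1 ∘ g, w.1.2), fun l m => w.2 (g l) m⟩

theorem dist_reindex_le {L L' M : ℕ} (g : Fin (L' + 1) → Fin (L + 1)) (v w : π.Space L M) :
    dist (π.reindex M g v) (π.reindex M g w) ≤ dist v w := by
  rw [Subtype.dist_eq, Subtype.dist_eq, Prod.dist_eq, Prod.dist_eq]
  refine max_le_max ?_ le_rfl
  exact (dist_pi_le_iff dist_nonneg).2 fun l => dist_le_pi_dist v.1.1 w.1.1 (g l)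

theorem reindex_iterate {L L' M : ℕ} (g : Fin (L' + 1) → Fin (L + 1)) (n : ℕ)
    (w : π.Space L M) :
    π.reindex M g ((π.sys L M).φ^[n] w) = (π.sys L' M).φ^[n] (π.reindex M g w) := by
  induction n with
  | zero => rfl
  | succ n ih =>
    simp only [Function.iterate_succ_apply']
    rw [← ih]
    rfl

theorem stablyEquiv_reindex {L L' M : ℕ} (g : Fin (L' + 1) → Fin (L + 1)) {v w : π.Space L M}
    (h : (π.sys L M).StablyEquiv v w) :
    (π.sys L' M).StablyEquiv (π.reindex M g v) (π.reindex M g w) := by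
  refine squeeze_zero (fun _ => dist_nonneg) (fun n => ?_) h
  rw [← reindex_iterate, ← reindex_iterate]
  exact π.dist_reindex_le g _ _

theorem isBracket_reindex {L L' M : ℕ} (g : Fin (L' + 1) → Fin (L + 1)) {u v w : π.Space L M}
    (h : (π.sys L M).IsBracket u v w) :
    (π.sys L' M).IsBracket (π.reindex M g u) (π.reindex M g v) (π.reindex M g w) :=
  ⟨fun l => h.1 (g l), h.2⟩

theorem iterate_coord {L M : ℕ} (n : ℕ) (w : π.Space L M) (l : Fin (L + 1)) :
    ((π.sys L M).φ^[n] w).1.1 l = SY.φ^[n] (w.1.1 l) := by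
  induction n with
  | zero => rfl
  | succ n ih =>
    simp only [Function.iterate_succ_apply']
    rw [← ih]
    rfl

theorem stablyEquiv_coord {L M : ℕ} {v w : π.Space L M} (h : (π.sys L M).StablyEquiv v w)
    (l : Fin (L + 1)) : SY.sys.StablyEquiv (v.1.1 l) (w.1.1 l) := by
  refine squeeze_zero (fun _ => dist_nonneg) (fun n => ?_) h
  change dist (SY.φ^[n] (v.1.1 l)) (SY.φ^[n] (w.1.1 l)) ≤ _
  rw [← iterate_coord, ← iterate_coord, Subtype.dist_eq, Prod.dist_eq]
  exact (dist_le_pi_dist _ _ l).trans (le_max_left _ _)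

theorem coord_eq {L M : ℕ} {v w : π.Space L M} {l l' : Fin (L + 1)}
    (hl : SY.sys.StablyEquiv (v.1.1 l) (w.1.1 l))
    (hl' : SY.sys.StablyEquiv (v.1.1 l') (w.1.1 l')) (h : v.1.1 l = v.1.1 l') :
    w.1.1 l = w.1.1 l' := by
  rw [← h] at hl'
  exact (π.πs_bijOn (v.1.1 l)).injOn hl hl' ((w.2 l 0).trans (w.2 l' 0).symm)

theorem continuous_reindex {L L' M : ℕ} (g : Fin (L' + 1) → Fin (L + 1)) :
    @Continuous _ _ (π.sys L M).stableTopology (π.sys L' M).stableTopology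
      (π.reindex M g) := by
  refine @Continuous.mk _ _ (π.sys L M).stableTopology (π.sys L' M).stableTopology _ ?_
  intro U hU v hv
  obtain ⟨δ, hδ, h⟩ := hU _ hv
  exact ⟨δ, hδ, fun w hd hb =>
    h _ ((π.dist_reindex_le g v w).trans_lt hd) (π.isBracket_reindex g hb)⟩

theorem stableMap_reindex {L L' : ℕ} (M : ℕ) {g : Fin (L' + 1) → Fin (L + 1)}
    (hg : Function.Surjective g) :
    (π.sys L M).StableMap (π.sys L' M) (π.reindex M g) := by
  obtain ⟨h, hgh⟩ := hg.hasRightInverse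
  have hr : ∀ w : π.Space L M, π.reindex M h (π.reindex M g w) = w := fun w =>
    Subtype.ext (Prod.ext (funext fun l => congrArg w.1.1 (hgh l)) rfl)
  have hr' : ∀ (v : π.Space L M) (w : π.Space L' M),
      (∀ l, SY.sys.StablyEquiv ((π.reindex M g v).1.1 l) (w.1.1 l)) →
      π.reindex M g (π.reindex M h w) = w := fun v w hvw =>
    Subtype.ext (Prod.ext (funext fun l =>
      π.coord_eq (v := π.reindex M g v) (hvw _) (hvw l) (congrArg v.1.1 (hgh (g l)))) rfl)
  refine ⟨fun _ => rfl, fun _ _ _ => π.isBracket_reindex g, fun v => ⟨?_, ?_, ?_⟩, ?_⟩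
  · exact fun w hw => π.stablyEquiv_reindex g hw
  · intro a _ b _ hab
    rw [← hr a, hab, hr b]
  · intro w hw
    refine ⟨π.reindex M h w, ?_, hr' v w (π.stablyEquiv_coord hw)⟩
    have := π.stablyEquiv_reindex h hw
    rwa [hr] at this
  · rintro E ⟨⟨e, he⟩, hc, ho⟩
    refine ⟨⟨π.reindex M g e, ?_⟩, ?_, ?_⟩
    · rintro _ ⟨w, hw, rfl⟩
      exact π.stablyEquiv_reindex g (he hw)
    · exact @IsCompact.image _ _ (π.sys L M).stableTopology (π.sys L' M).stableTopology _ _ hc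
        (π.continuous_reindex g)
    · rintro _ ⟨v, hv, rfl⟩
      obtain ⟨δ, hδ, hU⟩ := ho v hv
      refine ⟨δ, hδ, fun w hd hb => ⟨π.reindex M h w, hU _ ?_ ?_, hr' v w fun l =>
        SY.stablyEquiv_of_isBracket (hb.1 l)⟩⟩
      · have := π.dist_reindex_le h (π.reindex M g v) w
        rw [hr] at this
        exact this.trans_lt hd
      · have := π.isBracket_reindex h hb
        rwa [hr] at this

/-! ### Chains, degenerate chains and the complex `C_Q` -/

/-- `C_{L,M} = D^s(Σ_{L,M})`. -/
abbrev C (L M : ℕ) : Type _ := (π.sys L M).Ds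

/-- The action of `α` in the symmetric group `S_{L+1}` on `C_{L,M}` induced by the
permutation `α(y)_{α(l)} = y_l` of the entries `y_0, …, y_L`. -/
def permMap (L M : ℕ) (α : Equiv.Perm (Fin (L + 1))) : π.C L M →+ π.C L M :=
  (π.stableMap_reindex M (g := α.symm) α.symm.surjective).dsMap

theorem insertNth_surjective {L : ℕ} (l : Fin (L + 1)) (p : Fin (L + 2)) :
    Function.Surjective (p.insertNth l id : Fin (L + 2) → Fin (L + 1)) :=
  fun i => ⟨p.succAbove i, by simp⟩

/-- The homomorphism `C_{L,M} → C_{L+1,M}` induced by the degeneracy which repeats the entry `y_l`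
at coordinate `p`,
`(y_0, …, y_L) ↦ (y_0, …, y_l, …, y_{p-1}, y_l, y_p, …, y_L)`.
For `p = l + j`, `j ≥ 1`, this is `(σ_j s_l)^s`. -/
def degMap (L M : ℕ) (l : Fin (L + 1)) (p : Fin (L + 2)) : π.C L M →+ π.C (L + 1) M :=
  (π.stableMap_reindex M (insertNth_surjective l p)).dsMap

/-- The sum of the images of all the degeneracies `(σ_j s_l)^s`; it is zero for `L = 0`. -/
def degImages : (L M : ℕ) → AddSubgroup (π.C L M)
  | 0, _ => ⊥
  | L + 1, M => ⨆ (l : Fin (L + 1)) (p : Fin (L + 2)) (_ : l.castSucc < p), (π.degMap L M l p).range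

/-- The group `DC_{L,M}` of degenerate chains. -/
def DC (L M : ℕ) : AddSubgroup (π.C L M) :=
  π.degImages L M ⊔ AddSubgroup.closure
    {b | ∃ (a : π.C L M) (α : Equiv.Perm (Fin (L + 1))),
      b = π.permMap L M α a - (Equiv.Perm.sign α : ℤ) • a}

/-- The subgroup `D^s_B(Σ_{L,M})`. -/
def DB (L M : ℕ) : AddSubgroup (π.C L M) :=
  AddSubgroup.closure
    ({a | ∃ α : Equiv.Perm (Fin (L + 1)), α.IsSwap ∧ π.permMap L M α a = a} ∪
     {b | ∃ (a : π.C L M) (α : Equiv.Perm (Fin (L + 1))),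
      b = a - (Equiv.Perm.sign α : ℤ) • π.permMap L M α a})

/-- `(C_Q)_{L,M} = D^s(Σ_{L,M}) / D^s_B(Σ_{L,M})`. -/
abbrev CQ (L M : ℕ) : Type _ := π.C L M ⧸ π.DB L M

end SUBijectivePair

end

/-! ### Expansiveness of Smale spaces -/

namespace SmaleSpace

variable {X : Type*} [MetricSpace X] [CompactSpace X]

/-! The geometric core is a uniform bound on the fibers of `π.πs`. If `y`, `y'` are close points of
one fiber, the orbit of `[y, y']` shadows that of `y` forwards and that of `y'` backwards; so its
image shadows `π.πs y` for all time and, by expansiveness, equals it. Injectivity of `π.πs` on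
stable sets then gives `[y, y'] = y`: close fiber points are unstably related, so the inverse
dynamics contracts them. Hence distinct fiber points are eventually `δ`-apart with `δ` uniform
(`exists_eventually_lt_dist_iterate`), and a finite fiber has at most as many points as a fixed
finite cover of `Y` has balls (`bddAbove_ncard_fiber`).

The rest is pigeonhole. A tuple with more than `K` entries in one fiber has two equal entries, and
by injectivity on stable sets they agree along its whole stable orbit. So every compact open set of
that orbit is the image of a degeneracy and is fixed by a transposition. Such classes generate the
dimension group, which gives all three claims. -/

/-- The inverse Smale space: the dynamics is inverted and the bracket is flipped. -/
def symm (S : SmaleSpace X) : SmaleSpace X where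
  φ := S.φ.symm
  br x y := S.br y x
  ε := S.ε
  lam := S.lam
  ε_pos := S.ε_pos
  lam_pos := S.lam_pos
  lam_lt_one := S.lam_lt_one
  br_continuous := S.br_continuous.comp continuous_swap.continuousOn fun p hp => by
    simpa [dist_comm] using hp
  br_self := S.br_self
  br_br_right x y z h1 h2 h3 := by
    rw [dist_comm] at h1 h2 h3
    exact S.br_br_left z y x h1 h2 h3
  br_br_left x y z h1 h2 h3 := by
    rw [dist_comm] at h1 h2 h3
    exact S.br_br_right z y x h1 h2 h3
  br_map x y h1 h2 := by
    rw [dist_comm] at h1 h2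
    rw [Homeomorph.symm_apply_eq, S.br_map _ _ h2 (by simpa using h1)]
    simp
  contract y z h1 h2 := by
    rw [dist_comm] at h1
    simpa [dist_comm] using S.contract_symm z y h1 h2
  contract_symm y z h1 h2 := by
    rw [dist_comm] at h1
    simpa [dist_comm] using S.contract z y h1 h2

variable (S : SmaleSpace X)

theorem exists_dist_br_le {η : ℝ} (hη : 0 < η) : ∃ δ > 0, δ ≤ S.ε ∧
    ∀ x y, dist x y ≤ δ → dist x (S.br x y) ≤ η ∧ dist y (S.br x y) ≤ η := by
  have hcl : IsClosed {p : X × X | dist p.1 p.2 ≤ S.ε} :=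
    isClosed_le (continuous_fst.dist continuous_snd) continuous_const
  have huc := hcl.isCompact.uniformContinuousOn_of_continuous S.br_continuous
  obtain ⟨δ, hδ, h⟩ := Metric.uniformContinuousOn_iff.1 huc (η / 2) (half_pos hη)
  -- `δ / 2` keeps `(x, y)` strictly within `δ` of the diagonal point `(x, x)`, where the bracket is
  -- `x`; `η / 2` pays for the triangle inequality from `y`.
  refine ⟨min (min (δ / 2) (η / 2)) S.ε,
    lt_min (lt_min (half_pos hδ) (half_pos hη)) S.ε_pos, min_le_right _ _, fun x y hxy => ?_⟩
  have h1 : dist x y ≤ δ / 2 := hxy.trans ((min_le_left _ _).trans (min_le_left _ _))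
  have h2 : dist x y ≤ η / 2 := hxy.trans ((min_le_left _ _).trans (min_le_right _ _))
  have h3 : dist x y ≤ S.ε := hxy.trans (min_le_right _ _)
  have h4 := h (x, x) (by simp [S.ε_pos.le]) (x, y) h3 (by
    rw [Prod.dist_eq]
    simp only [dist_self]
    exact max_lt hδ (by linarith))
  simp only [S.br_self] at h4
  have h5 := dist_triangle y x (S.br x y)
  rw [dist_comm y x] at h5
  exact ⟨by linarith, by linarith⟩

/-- Contraction keeps the pair in the domain of the bracket, so the local stable relation persists
and the contraction can be applied again. -/
theorem dist_iterate_le {y z : X} (hd : dist y z ≤ S.ε) (hb : S.br y z = z) (n : ℕ) :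
    dist (S.φ^[n] y) (S.φ^[n] z) ≤ dist y z := by
  suffices h : dist (S.φ^[n] y) (S.φ^[n] z) ≤ dist y z ∧
      S.br (S.φ^[n] y) (S.φ^[n] z) = S.φ^[n] z from h.1
  induction n with
  | zero => exact ⟨le_rfl, hb⟩
  | succ n ih =>
    obtain ⟨h1, h2⟩ := ih
    simp only [Function.iterate_succ_apply']
    have h3 : dist (S.φ (S.φ^[n] y)) (S.φ (S.φ^[n] z)) ≤ dist y z :=
      (S.contract _ _ (h1.trans hd) h2).trans
        ((mul_le_of_le_one_left dist_nonneg S.lam_lt_one.le).trans h1)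
    exact ⟨h3, by rw [← S.br_map _ _ (h1.trans hd) (h3.trans hd), h2]⟩

theorem br_br_self {x y : X} (h1 : dist x y ≤ S.ε) (h2 : dist x (S.br x y) ≤ S.ε) :
    S.br x (S.br x y) = S.br x y :=
  S.br_br_right x x y h1 h2 h1

theorem br_iterate_symm {a b : X}
    (h : ∀ n : ℕ, dist (S.φ.symm^[n] a) (S.φ.symm^[n] b) ≤ S.ε) (n : ℕ) :
    S.br (S.φ.symm^[n] a) (S.φ.symm^[n] b) = S.φ.symm^[n] (S.br a b) := by
  induction n with
  | zero => rfl
  | succ n ih =>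
    have h1 := h (n + 1)
    simp only [Function.iterate_succ_apply'] at h1 ⊢
    rw [← ih]
    exact (S.symm.br_map _ _ ((dist_comm _ _).trans_le (h n))
      ((dist_comm _ _).trans_le h1)).symm

theorem le_zero_of_forall_le_pow_mul {d r c : ℝ} (hr : 0 ≤ r) (hr1 : r < 1)
    (h : ∀ n : ℕ, d ≤ r ^ n * c) : d ≤ 0 :=
  ge_of_tendsto' (by simpa using (tendsto_pow_atTop_nhds_zero_of_lt_one hr hr1).mul_const c) h

/-- The stable relation holds all along the backward orbits, which stay within `ε`. Contracting
forwards from time `-n` gives `d(a, c) ≤ λ^n ε` for every `n`. -/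
theorem eq_of_br_eq_right {a c : X}
    (h : ∀ n : ℕ, dist (S.φ.symm^[n] a) (S.φ.symm^[n] c) ≤ S.ε) (hb : S.br a c = c) :
    a = c := by
  have key : ∀ n : ℕ, dist a c ≤ S.lam ^ n * dist (S.φ.symm^[n] a) (S.φ.symm^[n] c) := by
    intro n
    induction n with
    | zero => simp
    | succ n ih =>
      refine ih.trans ?_
      rw [pow_succ, mul_assoc]
      refine mul_le_mul_of_nonneg_left ?_ (pow_nonneg S.lam_pos.le n)
      have := S.contract _ _ (h (n + 1)) (by rw [S.br_iterate_symm h, hb])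
      simpa only [Function.iterate_succ_apply', Homeomorph.apply_symm_apply] using this
  exact dist_le_zero.1 (le_zero_of_forall_le_pow_mul S.lam_pos.le S.lam_lt_one fun n =>
    (key n).trans (mul_le_mul_of_nonneg_left (h n) (pow_nonneg S.lam_pos.le n)))

/-- The point `[a, b]` is stably related to `a`, and its backward orbit stays near that of `a`
because the bracket commutes with the inverse dynamics; so it is `a`. -/
theorem exists_br_eq_left : ∃ δ > 0, ∀ a b : X,
    (∀ n : ℕ, dist (S.φ.symm^[n] a) (S.φ.symm^[n] b) ≤ δ) → S.br a b = a := by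
  obtain ⟨δ, hδ, hδε, hbr⟩ := S.exists_dist_br_le S.ε_pos
  refine ⟨δ, hδ, fun a b h => (S.eq_of_br_eq_right (fun n => ?_) ?_).symm⟩
  · rw [← S.br_iterate_symm fun n => (h n).trans hδε]
    exact (hbr _ _ (h n)).1
  · exact S.br_br_self ((h 0).trans hδε) (hbr _ _ (h 0)).1

/-- Smale spaces are expansive. -/
theorem expansive : ∃ δ > 0, ∀ a b : X, (∀ n : ℕ, dist (S.φ^[n] a) (S.φ^[n] b) ≤ δ) →
    (∀ n : ℕ, dist (S.φ.symm^[n] a) (S.φ.symm^[n] b) ≤ δ) → a = b := by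
  obtain ⟨δ, hδ, h⟩ := S.exists_br_eq_left
  obtain ⟨δ', hδ', h'⟩ := S.symm.exists_br_eq_left
  refine ⟨min δ δ', lt_min hδ hδ', fun a b h1 h2 => ?_⟩
  have ha : S.br a b = a := h a b fun n => (h2 n).trans (min_le_left _ _)
  -- In the inverse Smale space the bracket is flipped, so closeness of the forward orbits yields
  -- the other half.
  have hb : S.br a b = b := h' b a fun n => by
    rw [dist_comm]
    exact (h1 n).trans (min_le_right _ _)
  exact ha.symm.trans hb

end SmaleSpace

/-! ### Generators of the dimension group -/

namespace BracketSystem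

variable {T : Type*} [MetricSpace T] (S : BracketSystem T)

/-- The dimension group is generated by the classes of the compact open sets. -/
theorem closure_range_gen : AddSubgroup.closure (range S.gen) = ⊤ := by
  refine eq_top_iff.2 fun a _ => ?_
  obtain ⟨a, rfl⟩ := QuotientAddGroup.mk_surjective a
  induction a using FreeAbelianGroup.induction_on with
  | zero => exact zero_mem _
  | of q =>
    obtain ⟨E, rfl⟩ := Quotient.mk_surjective q
    exact AddSubgroup.subset_closure ⟨E, rfl⟩
  | neg q h => exact neg_mem (h trivial)
  | add a b ha hb => exact add_mem (ha trivial) (hb trivial)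

theorem stablyEquiv_refl (x : T) : S.StablyEquiv x x := by simp [StablyEquiv]

end BracketSystem

namespace SUBijectivePair

variable {X Y Z : Type*} [MetricSpace X] [CompactSpace X] [MetricSpace Y]
  [CompactSpace Y] [MetricSpace Z] [CompactSpace Z]
  {SX : SmaleSpace X} {SY : SmaleSpace Y} {SZ : SmaleSpace Z} (π : SUBijectivePair SX SY SZ)

/-! ### The fibers of an s-bijective map have bounded cardinality -/

theorem πs_iterate (n : ℕ) (y : Y) : π.πs (SY.φ^[n] y) = SX.φ^[n] (π.πs y) :=
  Function.Semiconj.iterate_right (f := π.πs) π.πs_map n y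

theorem πs_symm_iterate (n : ℕ) (y : Y) :
    π.πs (SY.φ.symm^[n] y) = SX.φ.symm^[n] (π.πs y) := by
  refine Function.Semiconj.iterate_right (f := π.πs) (fun y => ?_) n y
  rw [Homeomorph.eq_symm_apply, ← π.πs_map, Homeomorph.apply_symm_apply]

/-- Nearby points of a fiber lie in the same local unstable set. -/
theorem exists_br_eq_left_of_πs_eq : ∃ δ > 0, δ ≤ SY.ε ∧
    ∀ y y' : Y, π.πs y = π.πs y' → dist y y' ≤ δ → SY.br y y' = y := by
  obtain ⟨δX, hδX, hexp⟩ := SX.expansive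
  obtain ⟨η, hη, hπ⟩ := Metric.uniformContinuous_iff.1
    (CompactSpace.uniformContinuous_of_continuous π.πs_continuous) δX hδX
  obtain ⟨δ, hδ, hδε, hbr⟩ := SY.exists_dist_br_le (lt_min (half_pos hη) SY.ε_pos)
  refine ⟨δ, hδ, hδε, fun y y' hyy' hd => ?_⟩
  obtain ⟨h1, h2⟩ := hbr y y' hd
  have hε := hd.trans hδε
  have h1ε := h1.trans (min_le_right _ _)
  have h2ε := h2.trans (min_le_right _ _)
  have hb1 : SY.br y (SY.br y y') = SY.br y y' := SY.br_br_self hε h1ε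
  have hb2 : SY.br (SY.br y y') y' = SY.br y y' :=
    SY.br_br_left y y' y' hε (by rwa [dist_comm]) hε
  have hlt := (min_le_left (η / 2) SY.ε).trans_lt (half_lt_self hη)
  -- Forwards the bracket is compared with `y`, backwards with `y'`, which has the same image.
  have hx : π.πs y = π.πs (SY.br y y') := by
    refine hexp _ _ (fun n => ?_) fun n => ?_
    · rw [← π.πs_iterate, ← π.πs_iterate]
      exact (hπ (((SY.dist_iterate_le h1ε hb1 n).trans h1).trans_lt hlt)).le
    · rw [hyy', ← π.πs_symm_iterate, ← π.πs_symm_iterate]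
      exact (hπ (((SY.symm.dist_iterate_le h2ε hb2 n).trans h2).trans_lt hlt)).le
  exact ((π.πs_bijOn y).injOn (SY.sys.stablyEquiv_refl y)
    (SY.stablyEquiv_of_isBracket ⟨h1ε, hb1⟩) hx).symm

/-- Distinct points of a fiber are eventually separated by a uniform distance. -/
theorem exists_eventually_lt_dist_iterate : ∃ δ > 0, ∀ y y' : Y, π.πs y = π.πs y' → y ≠ y' →
    ∀ᶠ n : ℕ in atTop, δ < dist (SY.φ^[n] y) (SY.φ^[n] y') := by
  obtain ⟨δ, hδ, hδε, h⟩ := π.exists_br_eq_left_of_πs_eq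
  refine ⟨δ, hδ, fun y y' hyy' hne => ?_⟩
  have hstep : ∀ n : ℕ, dist (SY.φ^[n + 1] y) (SY.φ^[n + 1] y') ≤ δ →
      dist (SY.φ^[n] y) (SY.φ^[n] y') ≤
        SY.lam * dist (SY.φ^[n + 1] y) (SY.φ^[n + 1] y') := by
    intro n hn
    have := SY.contract_symm _ _ (hn.trans hδε)
      (h _ _ (by rw [π.πs_iterate, π.πs_iterate, hyy']) hn)
    simpa only [Function.iterate_succ_apply', Homeomorph.symm_apply_apply] using this
  have hpow : ∀ n : ℕ, dist (SY.φ^[n] y) (SY.φ^[n] y') ≤ δ →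
      dist y y' ≤ SY.lam ^ n * δ := by
    -- Closeness at time `n` alone suffices: contracting backwards, it forces closeness at all
    -- earlier times.
    suffices key : ∀ n : ℕ, dist (SY.φ^[n] y) (SY.φ^[n] y') ≤ δ →
        dist y y' ≤ SY.lam ^ n * dist (SY.φ^[n] y) (SY.φ^[n] y') from fun n hn =>
      (key n hn).trans (mul_le_mul_of_nonneg_left hn (pow_nonneg SY.lam_pos.le n))
    intro n
    induction n with
    | zero => simp
    | succ n ih =>
      intro hn
      have hs := hstep n hn
      refine (ih (hs.trans ((mul_le_of_le_one_left dist_nonneg SY.lam_lt_one.le).trans hn))).trans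
        ?_
      rw [pow_succ, mul_assoc]
      exact mul_le_mul_of_nonneg_left hs (pow_nonneg SY.lam_pos.le n)
  have hlim : Tendsto (fun n : ℕ => SY.lam ^ n * δ) atTop (𝓝 0) := by
    simpa using (tendsto_pow_atTop_nhds_zero_of_lt_one SY.lam_pos.le SY.lam_lt_one).mul_const δ
  filter_upwards [hlim.eventually_lt_const (dist_pos.2 hne)] with n hn
  by_contra hle
  exact (hpow n (not_lt.1 hle)).not_gt hn

theorem bddAbove_ncard_fiber (hfin : ∀ x : X, (π.πs ⁻¹' {x}).Finite) :
    BddAbove (range fun x : X => (π.πs ⁻¹' {x}).ncard) := by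
  obtain ⟨δ, hδ, h⟩ := π.exists_eventually_lt_dist_iterate
  obtain ⟨t, -, htf, ht⟩ := (isCompact_univ (X := Y)).finite_cover_balls (half_pos hδ)
  refine ⟨t.ncard, ?_⟩
  rintro _ ⟨x, rfl⟩
  -- Finiteness of the fiber gives one time that separates all its pairs; this time depends on `x`,
  -- but `δ` and `t` do not.
  have hev : ∀ᶠ n : ℕ in atTop, ∀ y ∈ π.πs ⁻¹' {x}, ∀ y' ∈ π.πs ⁻¹' {x}, y ≠ y' →
      δ < dist (SY.φ^[n] y) (SY.φ^[n] y') := by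
    refine (hfin x).eventually_all.2 fun y hy => (hfin x).eventually_all.2 fun y' hy' => ?_
    by_cases hne : y = y'
    · exact Eventually.of_forall fun _ h => absurd hne h
    · exact (h y y' (Eq.trans hy (Eq.symm hy')) hne).mono fun _ h _ => h
  obtain ⟨n, hn⟩ := hev.exists
  have hc : ∀ y : Y, ∃ c ∈ t, dist y c < δ / 2 := fun y => by
    simpa using ht (mem_univ y)
  choose c hct hcd using hc
  refine ncard_le_ncard_of_injOn (fun y => c (SY.φ^[n] y)) (fun y _ => hct _) ?_ htf
  intro y hy y' hy' hcc
  by_contra hne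
  have h1 := hcd (SY.φ^[n] y)
  have h2 := hcd (SY.φ^[n] y')
  simp only at hcc
  rw [← hcc] at h2
  have h3 := dist_triangle_right (SY.φ^[n] y) (SY.φ^[n] y') (c (SY.φ^[n] y))
  linarith [hn y hy y' hy' hne]

/-! ### Degeneracy of the generators -/

theorem exists_lt_coord_eq {K : ℕ} (hfin : ∀ x : X, (π.πs ⁻¹' {x}).Finite)
    (hK : ∀ x : X, (π.πs ⁻¹' {x}).ncard ≤ K) {L M : ℕ} (hL : K ≤ L) (w : π.Space L M) :
    ∃ i j : Fin (L + 1), i < j ∧ w.1.1 i = w.1.1 j := by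
  by_contra! hne
  have hinj : Function.Injective w.1.1 := fun i j hij => by
    rcases lt_trichotomy i j with h | h | h
    · exact absurd hij (hne _ _ h)
    · exact h
    · exact absurd hij.symm (hne _ _ h)
  have hsub : range w.1.1 ⊆ π.πs ⁻¹' {π.πu (w.1.2 0)} := by
    rintro _ ⟨i, rfl⟩
    exact w.2 i 0
  have h1 := ncard_le_ncard hsub (hfin _)
  have h2 : (range w.1.1).ncard = L + 1 := by
    rw [← image_univ, ncard_image_of_injective _ hinj, ncard_univ, Nat.card_fin]
  have h3 := hK (π.πu (w.1.2 0))
  omega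

/-- Entries `i` and `j` of `w` are stably equivalent to the same point and have the same image under
`π.πs`. -/
theorem coord_eq_of_mem {L M : ℕ} {E : Set (π.Space L M)} {e w : π.Space L M}
    (he : E ⊆ (π.sys L M).stableSet e) {i j : Fin (L + 1)} (hij : e.1.1 i = e.1.1 j)
    (hw : w ∈ E) : w.1.1 i = w.1.1 j :=
  π.coord_eq (π.stablyEquiv_coord (he hw) i) (π.stablyEquiv_coord (he hw) j) hij

/-- A compact open set on which a reindexing is inverse to a right inverse of it is the
image of a compact open set. -/
theorem exists_co_image_eq {L L' M : ℕ} {g : Fin (L' + 1) → Fin (L + 1)}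
    {h : Fin (L + 1) → Fin (L' + 1)} (hgh : Function.RightInverse h g)
    (E : (π.sys L' M).CO) (hE : ∀ w ∈ E.1, π.reindex M g (π.reindex M h w) = w) :
    ∃ F : (π.sys L M).CO, π.reindex M g '' F.1 = E.1 := by
  have hr : ∀ w : π.Space L M, π.reindex M h (π.reindex M g w) = w := fun w =>
    Subtype.ext (Prod.ext (funext fun l => congrArg w.1.1 (hgh l)) rfl)
  -- As an image the set is compact, as a preimage it is open.
  have himg : π.reindex M h '' E.1 = π.reindex M g ⁻¹' E.1 := by
    ext v
    constructor
    · rintro ⟨w, hw, rfl⟩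
      rw [mem_preimage, hE w hw]
      exact hw
    · exact fun hv => ⟨_, hv, hr v⟩
  obtain ⟨⟨e, he⟩, hc, ho⟩ := E.2
  refine ⟨⟨π.reindex M h '' E.1, ⟨π.reindex M h e, ?_⟩, ?_, ?_⟩, ?_⟩
  · rintro _ ⟨w, hw, rfl⟩
    exact π.stablyEquiv_reindex h (he hw)
  · exact @IsCompact.image _ _ (π.sys L' M).stableTopology (π.sys L M).stableTopology _ _ hc
      (π.continuous_reindex h)
  · rw [himg]
    exact @IsOpen.preimage _ _ (π.sys L M).stableTopology (π.sys L' M).stableTopology _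
      (π.continuous_reindex g) _ ho
  · rw [image_image]
    exact (image_congr hE).trans (image_id' _)

theorem exists_gen_eq_degMap {L M : ℕ} (E : (π.sys (L + 1) M).CO) {e : π.Space (L + 1) M}
    (he : E.1 ⊆ (π.sys (L + 1) M).stableSet e) {i j : Fin (L + 2)} (hlt : i < j)
    (hij : e.1.1 i = e.1.1 j) :
    ∃ (l : Fin (L + 1)) (p : Fin (L + 2)), l.castSucc < p ∧ ∃ F : (π.sys L M).CO,
      (π.sys (L + 1) M).gen E = π.degMap L M l p ((π.sys L M).gen F) := by
  -- Since `i < j`, deleting entry `j` leaves the index `i` unchanged; the degeneracy then restores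
  -- entry `j` by repeating entry `i`.
  obtain ⟨l, rfl⟩ := Fin.exists_castSucc_eq.2 (Fin.ne_last_of_lt hlt)
  have hl : j.succAbove l = l.castSucc := Fin.succAbove_of_castSucc_lt _ _ hlt
  obtain ⟨F, hF⟩ := π.exists_co_image_eq (g := j.insertNth l id) (h := j.succAbove)
    (fun k => by simp) E fun w hw => by
      refine Subtype.ext (Prod.ext (funext fun k => ?_) rfl)
      change w.1.1 (j.succAbove ((j.insertNth l id : Fin (L + 2) → Fin (L + 1)) k)) = w.1.1 k
      rcases Fin.eq_self_or_eq_succAbove j k with rfl | ⟨m, rfl⟩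
      · rw [Fin.insertNth_apply_same, hl]
        exact π.coord_eq_of_mem he hij hw
      · rw [Fin.insertNth_apply_succAbove, id]
  refine ⟨l, j, hlt, F, ?_⟩
  rw [degMap, BracketSystem.StableMap.dsMap_gen]
  exact congrArg _ (Subtype.ext hF.symm)

theorem permMap_swap_gen {L M : ℕ} (E : (π.sys L M).CO) {e : π.Space L M}
    (he : E.1 ⊆ (π.sys L M).stableSet e) {i j : Fin (L + 1)} (hij : e.1.1 i = e.1.1 j) :
    π.permMap L M (Equiv.swap i j) ((π.sys L M).gen E) = (π.sys L M).gen E := by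
  rw [permMap, BracketSystem.StableMap.dsMap_gen]
  refine congrArg _ (Subtype.ext ((image_congr fun w hw => ?_).trans (image_id' _)))
  refine Subtype.ext (Prod.ext (funext fun k => ?_) rfl)
  change w.1.1 (Equiv.swap i j k) = w.1.1 k
  have hw' := π.coord_eq_of_mem he hij hw
  by_cases hi : k = i
  · rw [hi, Equiv.swap_apply_left, hw']
  · by_cases hj : k = j
    · rw [hj, Equiv.swap_apply_right, hw']
    · rw [Equiv.swap_apply_of_ne_of_ne hi hj]

end SUBijectivePair

/-! ### The proposition -/

theorem mainTheorem6 {X Y Z : Type*} [MetricSpace X] [CompactSpace X] [MetricSpace Y]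
    [CompactSpace Y] [MetricSpace Z] [CompactSpace Z]
    (SX : SmaleSpace X) (SY : SmaleSpace Y) (SZ : SmaleSpace Z)
    (π : SUBijectivePair SX SY SZ)
    (hfin : ∀ x : X, (π.πs ⁻¹' {x}).Finite) :
    ∃ K : ℕ, IsLUB (Set.range fun x : X => (π.πs ⁻¹' {x}).ncard) K ∧
      (∀ L M : ℕ, K + 1 ≤ L + 1 → ∀ E : (π.sys (L + 1) M).CO,
        ∃ (l : Fin (L + 1)) (p : Fin (L + 2)), l.castSucc < p ∧
          ∃ F : (π.sys L M).CO,
            (π.sys (L + 1) M).gen E = π.degMap L M l p ((π.sys L M).gen F)) ∧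
      (∀ L M : ℕ, K + 1 ≤ L → π.DC L M = ⊤) ∧
      (∀ L M : ℕ, K + 1 ≤ L → Subsingleton (π.CQ L M)) := by
  have hbdd := π.bddAbove_ncard_fiber hfin
  have hK : ∀ x, (π.πs ⁻¹' {x}).ncard ≤ sSup (range fun x : X => (π.πs ⁻¹' {x}).ncard) :=
    fun x => le_csSup hbdd ⟨x, rfl⟩
  -- In `ℕ` the supremum of the empty set is `0`, which covers empty `X`.
  refine ⟨_, isLUB_csSup' hbdd, ?_⟩
  generalize sSup (range fun x : X => (π.πs ⁻¹' {x}).ncard) = K at hK ⊢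
  have hdeg : ∀ L M : ℕ, K + 1 ≤ L + 1 → ∀ E : (π.sys (L + 1) M).CO,
      ∃ (l : Fin (L + 1)) (p : Fin (L + 2)), l.castSucc < p ∧ ∃ F : (π.sys L M).CO,
        (π.sys (L + 1) M).gen E = π.degMap L M l p ((π.sys L M).gen F) := by
    intro L M hL E
    obtain ⟨e, he⟩ := E.2.1
    -- The tuple has `L + 2` entries, so pigeonhole already works for `K ≤ L + 1`.
    obtain ⟨i, j, hlt, hij⟩ := π.exists_lt_coord_eq hfin hK ((Nat.le_succ K).trans hL) e
    exact π.exists_gen_eq_degMap E he hlt hij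
  refine ⟨hdeg, fun L M hL => ?_, fun L M hL => ?_⟩
  · obtain ⟨L, rfl⟩ := Nat.exists_eq_add_of_le' ((Nat.le_add_left 1 K).trans hL)
    rw [← top_le_iff, ← BracketSystem.closure_range_gen, AddSubgroup.closure_le]
    rintro _ ⟨E, rfl⟩
    obtain ⟨l, p, hlp, F, hF⟩ := hdeg L M hL E
    rw [hF]
    -- The degeneracy images alone exhaust the group; the sign relations are not needed.
    refine AddSubgroup.mem_sup_left ?_
    exact AddSubgroup.mem_iSup_of_mem l (AddSubgroup.mem_iSup_of_mem p
      (AddSubgroup.mem_iSup_of_mem hlp ⟨_, rfl⟩))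
  · refine QuotientAddGroup.subsingleton_iff.2 ?_
    rw [← top_le_iff, ← BracketSystem.closure_range_gen, AddSubgroup.closure_le]
    rintro _ ⟨E, rfl⟩
    obtain ⟨e, he⟩ := E.2.1
    obtain ⟨i, j, hlt, hij⟩ := π.exists_lt_coord_eq hfin hK ((Nat.le_succ K).trans hL) e
    -- Swapping two entries that agree on all of `E` fixes `E` pointwise.
    exact AddSubgroup.subset_closure (Or.inl ⟨Equiv.swap i j, ⟨i, j, hlt.ne, rfl⟩,
      π.permMap_swap_gen E he hij⟩)
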